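/- **Lemma 3.1 (Absorbing path).** There is a non-decreasing function $f:\mathbb{R}\to\mathbb{R}$ with $f(x)>0$ for every $x>0$ such that the following holds for all real numbers $\alpha,\beta,\gamma>0$ and every integer $n\ge 1$ with $$\alpha\le 1,\qquad \beta\le f(\alpha),\qquad \gamma\le f(\beta),\qquad \tfrac1n\le f(\gamma)$$ (that is, for $0<1/n\ll\gamma\ll\beta\ll\alpha\le 1$). Let $b$ and $c$ be any roundings, up or down, of $\beta n$ and $\gamma n$, i.e. non-negative integers with $|b-\beta n|<1$ and $|c-\gamma n|<1$. Then there exists an integer $0\le a\le 500\beta n$ such that, with $t:=a+b+1$, the following holds. Let $\mathbf{G}=(G_1,\dots,G_t)$ be an ordered collection of (simple, not necessarily distinct) graphs on the common vertex set $V=\{1,\dots,n\}$ such that every $G_i$ has minimum degree at least $(1/2+\alpha)n$. Let $Z\subseteq V$ have size $b+c+2$ and let $z_1,z_2\in Z$ be distinct. Then there exists a set $A\subseteq V\setminus Z$ of size $a$ such that, for every $Z'\subseteq Z\setminus\{z_1,z_2\}$ of size $b$, there is a path from $z_1$ to $z_2$ with exactly $t$ edges $e_1,\dots,e_t$ (in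 order from $z_1$ to $z_2$) whose set of internal vertices is exactly $A\cup Z'$ and with $e_i\in G_i$ for every $1\le i\le t$. -/

import Mathlib

/-- The internal vertices of a walk from `u` to `v`: the vertices it visits other than its ends. -/
def internalVertices {V : Type*} [DecidableEq V] {H : SimpleGraph V} {u v : V}
    (P : H.Walk u v) : Finset V :=
  P.support.toFinset \ {u, v}

/-- Let `G` be an ordered collection of `t` graphs on the vertex set `V`. A walk `P` in the complete
graph on `V` follows `G` if it has exactly `t` edges and its `i`-th edge is an edge of the `i`-th
graph of the collection, for every `i` (both are counted from `0` here). -/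
def FollowsCollection {V : Type*} {t : ℕ} (G : Fin t → SimpleGraph V) {u v : V}
    (P : (⊤ : SimpleGraph V).Walk u v) : Prop :=
  P.length = t ∧
    ∀ i : Fin t, s(P.getVert (i : ℕ), P.getVert ((i : ℕ) + 1)) ∈ (G i).edgeSet

open Finset

/-! The absorber follows a sparse bipartite graph `E` between X and Y ⊔ W, where W stands for `Z \
{z₁, z₂}`, which has a perfect matching of X with Y ∪ W' for every W' ⊆ W of size b
(`exists_robustly_matchable`: random expanders and Hall). Each x ∈ X and each edge e of `E` owns a
slot of the path: two fixed ends and an open middle. Each e also owns a vertex `y e`. The slot of x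
accepts `y e` for every e at x; the slot of e = (x, v) accepts `y e` or the vertex of v. Given a
matching, x takes the `y e` of its matching edge e, whose slot then takes v; every other edge slot
keeps its own `y e`. Thus exactly Y ∪ W' is absorbed, always at the same length. Any two vertices
have at least 2αn common neighbours across any two graphs, so all pieces can be chosen greedily
(`exists_absorber`). -/

/-! ### Random expanders and robust matchings -/

theorem choose_mul_pow_le_exp (p s : ℕ) :
    (p.choose s : ℝ) * (s : ℝ) ^ s ≤ (Real.exp 1 * p) ^ s := by
  have h1 : (p.choose s : ℝ) ≤ (p : ℝ) ^ s / s.factorial := Nat.choose_le_pow_div s p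
  have h2 : (s : ℝ) ^ s / s.factorial ≤ Real.exp s :=
    Real.pow_div_factorial_le_exp _ (Nat.cast_nonneg s) s
  have h3 : Real.exp s = Real.exp 1 ^ s := by rw [← Real.exp_nat_mul, mul_one]
  calc (p.choose s : ℝ) * (s : ℝ) ^ s ≤ (p : ℝ) ^ s / s.factorial * (s : ℝ) ^ s := by gcongr
    _ = (p : ℝ) ^ s * ((s : ℝ) ^ s / s.factorial) := by ring
    _ ≤ (p : ℝ) ^ s * Real.exp s := by gcongr
    _ = (Real.exp 1 * p) ^ s := by rw [h3, mul_pow, mul_comm]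

/-- The size-s term of the union bound in `exists_expander`. The exponent 12 is large enough because
e² · (3/2) · (2/3)^10 < 1/4. -/
theorem choose_mul_choose_mul_pow_le {p q s : ℕ} (hpq : 2 * p ≤ 3 * q) (hs : 3 * s ≤ 2 * q)
    (hs0 : 0 < s) (hsp : s ≤ p) :
    (p.choose s * q.choose s * (s ^ 12) ^ s * (q ^ 12) ^ (p - s) : ℝ) ≤
      (1 / 4) ^ s * (q ^ 12) ^ p := by
  have hq : (0 : ℝ) < q := by exact_mod_cast (by omega : 0 < q)
  have hs' : (0 : ℝ) < s := by exact_mod_cast hs0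
  have hpq' : (p : ℝ) ≤ 3 / 2 * q := by
    have : (2 * p : ℝ) ≤ 3 * q := by exact_mod_cast hpq
    linarith
  have hsq : (s : ℝ) ≤ 2 / 3 * q := by
    have : (3 * s : ℝ) ≤ 2 * q := by exact_mod_cast hs
    linarith
  have he : Real.exp 1 ^ 2 ≤ (7.4 : ℝ) := by
    have := Real.exp_one_lt_d9
    have h0 := Real.exp_pos 1
    nlinarith
  have hbase : (Real.exp 1 * p) * (Real.exp 1 * q) * (s : ℝ) ^ 10 ≤ 1 / 4 * (q : ℝ) ^ 12 := by
    calc (Real.exp 1 * p) * (Real.exp 1 * q) * (s : ℝ) ^ 10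
        = Real.exp 1 ^ 2 * p * q * (s : ℝ) ^ 10 := by ring
      _ ≤ (7.4 : ℝ) * (3 / 2 * q) * q * (2 / 3 * q) ^ 10 := by gcongr
      _ = (7.4 * (3 / 2) * (2 / 3) ^ 10) * (q : ℝ) ^ 12 := by ring
      _ ≤ 1 / 4 * (q : ℝ) ^ 12 := by
        gcongr
        norm_num
  calc (p.choose s * q.choose s * (s ^ 12) ^ s * (q ^ 12) ^ (p - s) : ℝ)
      = (p.choose s * (s : ℝ) ^ s) * (q.choose s * (s : ℝ) ^ s) * (s ^ 10) ^ s
          * (q ^ 12) ^ (p - s) := by ring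
    _ ≤ (Real.exp 1 * p) ^ s * (Real.exp 1 * q) ^ s * (s ^ 10) ^ s * (q ^ 12) ^ (p - s) := by
        have := choose_mul_pow_le_exp p s
        have := choose_mul_pow_le_exp q s
        gcongr
    _ = ((Real.exp 1 * p) * (Real.exp 1 * q) * (s : ℝ) ^ 10) ^ s * (q ^ 12) ^ (p - s) := by
        simp only [mul_pow]
    _ ≤ (1 / 4 * (q : ℝ) ^ 12) ^ s * (q ^ 12) ^ (p - s) := by gcongr
    _ = (1 / 4) ^ s * ((q ^ 12) ^ s * (q ^ 12) ^ (p - s)) := by rw [mul_pow]; ring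
    _ = (1 / 4) ^ s * (q ^ 12) ^ p := by rw [← pow_add, Nat.add_sub_cancel' hsp]

theorem sum_Icc_quarter_pow_lt_one (r : ℕ) : ∑ s ∈ Icc 1 r, (1 / 4 : ℝ) ^ s < 1 := by
  have h : ∑ s ∈ Icc 1 r, (1 / 4 : ℝ) ^ s = (1 - (1 / 4) ^ r) / 3 := by
    induction r with
    | zero => simp
    | succ k ih => rw [Finset.sum_Icc_succ_top (by omega), ih]; ring
  rw [h]
  have : (0 : ℝ) < (1 / 4) ^ r := by positivity
  linarith

theorem card_filter_maps_into {P Q : Type*} [Fintype P] [Fintype Q] [DecidableEq P]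
    [DecidableEq Q] {d : ℕ} (S : Finset P) (W : Finset Q) :
    #{φ : P → Fin d → Q | ∀ x ∈ S, ∀ i, φ x i ∈ W} =
      (#W ^ d) ^ #S *
        (Fintype.card Q ^ d) ^ (Fintype.card P - #S) := by
  have h : ({φ : P → Fin d → Q | ∀ x ∈ S, ∀ i, φ x i ∈ W} : Finset _) =
      Fintype.piFinset fun x ↦
        if x ∈ S then Fintype.piFinset (fun _ : Fin d ↦ W) else univ := by
    ext φ
    simp only [mem_filter, mem_univ, true_and, Fintype.mem_piFinset]
    refine forall_congr' fun x ↦ ?_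
    by_cases hx : x ∈ S <;> simp [hx]
  rw [h, Fintype.card_piFinset]
  simp only [apply_ite Finset.card, Fintype.card_piFinset, prod_const, card_univ,
    Fintype.card_fun, Fintype.card_fin]
  rw [Finset.prod_ite]
  simp only [prod_const, filter_mem_eq_inter, univ_inter, filter_not,
    card_univ_sdiff]

/-- Union bound over random maps: if φ fails at S, all its values on S lie in some set W with #W =
#S. Summed over pairs (S, W), these bad maps are fewer than all maps. -/
theorem exists_expander {P Q : Type*} [Fintype P] [Fintype Q] [DecidableEq P] [DecidableEq Q]
    {r : ℕ} (hPQ : 2 * Fintype.card P ≤ 3 * Fintype.card Q) (hr : 3 * r ≤ 2 * Fintype.card Q) :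
    ∃ φ : P → Fin 12 → Q, ∀ S : Finset P, #S ≤ r →
      #S ≤ #(S.biUnion fun x ↦ univ.image (φ x)) := by
  by_contra! hcon
  set p := Fintype.card P
  set q := Fintype.card Q
  have hcover : (univ : Finset (P → Fin 12 → Q)) ⊆
      (Icc 1 r).biUnion fun s ↦ (powersetCard s (univ : Finset P)).biUnion fun S ↦
        (powersetCard s (univ : Finset Q)).biUnion fun W ↦
          {φ : P → Fin 12 → Q | ∀ x ∈ S, ∀ i, φ x i ∈ W} := by
    intro φ _
    obtain ⟨S, hSr, hS⟩ := hcon φ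
    obtain ⟨W, hW, -, hWS⟩ := exists_subsuperset_card_eq (subset_univ _) hS.le
      (show #S ≤ #(univ : Finset Q) by rw [card_univ]; omega)
    simp only [mem_biUnion, mem_Icc, mem_powersetCard, subset_univ, true_and, mem_filter,
      mem_univ]
    refine ⟨#S, ⟨by omega, hSr⟩, S, rfl, W, hWS, fun x hx i ↦ hW ?_⟩
    exact mem_biUnion.2 ⟨x, hx, mem_image_of_mem _ (mem_univ i)⟩
  have hcard : (q ^ 12) ^ p ≤ ∑ s ∈ Icc 1 r,
      p.choose s * (q.choose s * ((s ^ 12) ^ s * (q ^ 12) ^ (p - s))) := by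
    have hu : #(univ : Finset (P → Fin 12 → Q)) = (q ^ 12) ^ p := by
      rw [card_univ, Fintype.card_fun, Fintype.card_fun, Fintype.card_fin]
    rw [← hu]
    refine (card_le_card hcover).trans <| card_biUnion_le.trans <| sum_le_sum fun s _ ↦ ?_
    have hP : #(powersetCard s (univ : Finset P)) = p.choose s := by
      rw [card_powersetCard, card_univ]
    have hQ : #(powersetCard s (univ : Finset Q)) = q.choose s := by
      rw [card_powersetCard, card_univ]
    rw [← hP, ← hQ]
    refine card_biUnion_le_card_mul _ _ _ fun S hS ↦ card_biUnion_le_card_mul _ _ _ fun W hW ↦ ?_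
    rw [card_filter_maps_into, (mem_powersetCard.1 hS).2, (mem_powersetCard.1 hW).2]
  have hreal : ((q : ℝ) ^ 12) ^ p ≤ ∑ s ∈ Icc 1 r, (1 / 4) ^ s * ((q : ℝ) ^ 12) ^ p := by
    have : ((q : ℝ) ^ 12) ^ p ≤ ∑ s ∈ Icc 1 r,
      (p.choose s : ℝ) * (q.choose s * ((s ^ 12) ^ s * (q ^ 12) ^ (p - s))) := by
      exact_mod_cast hcard
    refine this.trans (sum_le_sum fun s hs ↦ ?_)
    rw [mem_Icc] at hs
    rcases le_or_gt s p with hsp | hsp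
    · rw [← mul_assoc, ← mul_assoc]
      exact choose_mul_choose_mul_pow_le hPQ (by omega) (by omega) hsp
    · rw [Nat.choose_eq_zero_of_lt hsp]
      simp only [Nat.cast_zero, zero_mul]
      positivity
  have hpos : 0 < (q ^ 12) ^ p := by
    rcases Nat.eq_zero_or_pos q with h | h
    · rw [show p = 0 by omega, pow_zero]; exact one_pos
    · positivity
  have hpos' : (0 : ℝ) < ((q : ℝ) ^ 12) ^ p := by exact_mod_cast hpos
  rw [← sum_mul] at hreal
  nlinarith [sum_Icc_quarter_pow_lt_one r]

/-- There is a bipartite graph with classes `X` and `Y ⊕ W`, of linear size, which for any `b`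
vertices of `W` has a perfect matching between `X` and the union of `Y` with these vertices. -/
theorem exists_robustly_matchable (b c : ℕ) (hcb : c ≤ b) :
    ∃ E : Finset (Fin (3 * b) × (Fin (2 * b) ⊕ Fin (b + c))),
      #E ≤ 72 * b + 12 * c ∧
      ∀ W' : Finset (Fin (b + c)), #W' = b →
        ∃ m : Fin (3 * b) → Fin (2 * b) ⊕ Fin (b + c),
          (∀ x, (x, m x) ∈ E) ∧ univ.image m = (univ : Finset (Fin (2 * b))).disjSum W' := by
  obtain ⟨φ, hφ⟩ := exists_expander (P := Fin (3 * b)) (Q := Fin (2 * b)) (r := b)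
    (by simp; omega) (by simp; omega)
  obtain ⟨ψ, hψ⟩ := exists_expander (P := Fin (2 * b) ⊕ Fin (b + c)) (Q := Fin (3 * b))
    (r := 2 * b) (by simp; omega) (by simp; omega)
  set E : Finset (Fin (3 * b) × (Fin (2 * b) ⊕ Fin (b + c))) :=
    univ.image (fun a : Fin (3 * b) × Fin 12 ↦ (a.1, Sum.inl (φ a.1 a.2))) ∪
      univ.image (fun a : (Fin (2 * b) ⊕ Fin (b + c)) × Fin 12 ↦ (ψ a.1 a.2, a.1)) with hE
  have hEφ : ∀ x i, (x, Sum.inl (φ x i)) ∈ E := fun x i ↦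
    mem_union_left _ (mem_image.2 ⟨(x, i), mem_univ _, rfl⟩)
  have hEψ : ∀ v i, (ψ v i, v) ∈ E := fun v i ↦
    mem_union_right _ (mem_image.2 ⟨(v, i), mem_univ _, rfl⟩)
  refine ⟨E, ?_, fun W' hW' ↦ ?_⟩
  · refine (card_union_le _ _).trans ((add_le_add card_image_le card_image_le).trans ?_)
    simp only [card_univ, Fintype.card_prod, Fintype.card_fin, Fintype.card_sum]
    omega
  set T : Finset (Fin (2 * b) ⊕ Fin (b + c)) := (univ : Finset (Fin (2 * b))).disjSum W'
  have hT : #T = 3 * b := by rw [card_disjSum, hW', card_univ, Fintype.card_fin]; omega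
  have hall : ∀ S : Finset (Fin (3 * b)),
      #S ≤ #(S.biUnion fun x ↦ {v ∈ T | (x, v) ∈ E}) := by
    intro S
    by_contra! hlt
    set N := S.biUnion fun x ↦ {v ∈ T | (x, v) ∈ E} with hN
    -- Small S already expands into Y through φ. For large S, the vertices of T outside N have all
    -- their ψ-values in `Sᶜ`; one more of them than #Sᶜ is still at most 2b, so ψ expands them, a
    -- contradiction.
    rcases le_or_gt (#S) b with hS | hS
    · have hsub : (S.biUnion fun x ↦ univ.image (φ x)).map Function.Embedding.inl ⊆ N := by
        intro v hv
        simp only [mem_map, mem_biUnion, mem_image, mem_univ, true_and] at hv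
        obtain ⟨_, ⟨x, hx, i, rfl⟩, rfl⟩ := hv
        exact mem_biUnion.2 ⟨x, hx, mem_filter.2
          ⟨inl_mem_disjSum.2 (mem_univ _), hEφ x i⟩⟩
      have := card_le_card hsub
      rw [card_map] at this
      have := hφ S hS
      omega
    · have hNT : N ⊆ T := biUnion_subset.2 fun x _ ↦ filter_subset _ _
      have hSle : #S ≤ 3 * b := by simpa using card_le_univ S
      obtain ⟨T', hT', hT'c⟩ := exists_subset_card_eq (s := T \ N) (n := 3 * b - #S + 1)
        (by rw [card_sdiff_of_subset hNT]; omega)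
      have hsub : (T'.biUnion fun v ↦ univ.image (ψ v)) ⊆ Sᶜ := by
        intro x hx
        simp only [mem_biUnion, mem_image, mem_univ, true_and] at hx
        obtain ⟨v, hv, i, rfl⟩ := hx
        rw [mem_compl]
        intro hxS
        have hv' := mem_sdiff.1 (hT' hv)
        exact hv'.2 (mem_biUnion.2 ⟨_, hxS, mem_filter.2 ⟨hv'.1, hEψ v i⟩⟩)
      have h1 := card_le_card hsub
      have h2 := hψ T' (by omega)
      rw [card_compl, Fintype.card_fin] at h1
      omega
  obtain ⟨m, hm, hmE⟩ := (all_card_le_biUnion_card_iff_exists_injective _).1 hall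
  refine ⟨m, fun x ↦ (mem_filter.1 (hmE x)).2, ?_⟩
  refine eq_of_subset_of_card_le (image_subset_iff.2 fun x _ ↦ (mem_filter.1 (hmE x)).1) ?_
  rw [card_image_of_injective _ hm, hT, card_univ, Fintype.card_fin]

/-! ### Greedy choices and assembling paths -/

/-- Hall's condition is immediate, since each list keeps at least |I| elements after removing F. -/
theorem exists_injective_mem_notMem {I V : Type*} [Fintype I] [DecidableEq V] (N : I → Finset V)
    (F : Finset V) (h : ∀ i, #F + Fintype.card I ≤ #(N i)) :
    ∃ g : I → V, (∀ i, g i ∈ N i) ∧ #(F ∪ univ.image g) = #F + Fintype.card I ∧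
      Function.Injective g ∧ ∀ i, g i ∉ F := by
  obtain ⟨g, hg, hgN⟩ := (all_card_le_biUnion_card_iff_exists_injective fun i ↦ N i \ F).1 <| by
    intro S
    rcases S.eq_empty_or_nonempty with rfl | ⟨i, hi⟩
    · simp
    · have h1 := card_le_card (subset_biUnion_of_mem (fun i ↦ N i \ F) hi)
      have h2 := le_card_sdiff F (N i)
      have h3 := card_le_univ S
      have h4 := h i
      omega
  have hF : ∀ i, g i ∉ F := fun i ↦ (mem_sdiff.1 (hgN i)).2
  refine ⟨g, fun i ↦ (mem_sdiff.1 (hgN i)).1, ?_, hg, hF⟩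
  rw [card_union_of_disjoint, card_image_of_injective _ hg, card_univ]
  rw [disjoint_right]
  intro v hv
  obtain ⟨i, -, rfl⟩ := mem_image.1 hv
  exact hF i

theorem exists_walk_of_adj {V : Type*} {H : SimpleGraph V} (t : ℕ) (p : ℕ → V)
    (h : ∀ i < t, H.Adj (p i) (p (i + 1))) :
    ∃ P : H.Walk (p 0) (p t), P.length = t ∧ ∀ i ≤ t, P.getVert i = p i := by
  induction t generalizing p with
  | zero => exact ⟨.nil, rfl, fun i hi ↦ by rw [Nat.le_zero.1 hi]; rfl⟩
  | succ t ih =>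
    obtain ⟨P, hP, hv⟩ := ih (fun i ↦ p (i + 1)) fun i hi ↦ h (i + 1) (by omega)
    refine ⟨.cons (h 0 (by omega)) P, by simp [hP], fun i hi ↦ ?_⟩
    cases i with
    | zero => rfl
    | succ i => rw [SimpleGraph.Walk.getVert_cons_succ, hv i (by omega)]

/-- The walk has at most #B + 2 entries, and B with the two ends needs that many, so nothing
repeats. Hence only coverage of B has to be checked for the absorbing path. -/
theorem SimpleGraph.Walk.isPath_and_internalVertices_eq {V : Type*} [DecidableEq V]
    {H : SimpleGraph V} {u v : V} (P : H.Walk u v) {B : Finset V} (huv : u ≠ v) (hu : u ∉ B)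
    (hv : v ∉ B) (hB : P.length ≤ #B + 1) (hsub : B ⊆ P.support.toFinset) :
    P.IsPath ∧ internalVertices P = B := by
  have hsub' : insert u (insert v B) ⊆ P.support.toFinset := by
    refine insert_subset (by simp) (insert_subset (by simp) hsub)
  have hcard : #(insert u (insert v B)) = #B + 2 := by
    rw [card_insert_of_notMem (by simp [huv, hu]), card_insert_of_notMem hv]
  have hle := P.support.toFinset_card_le
  rw [SimpleGraph.Walk.length_support] at hle
  have heq := eq_of_subset_of_card_le hsub' (by omega)
  constructor
  · rw [SimpleGraph.Walk.isPath_def, ← Multiset.coe_nodup,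
      ← Multiset.toFinset_card_eq_card_iff_nodup]
    change #P.support.toFinset = P.support.length
    rw [SimpleGraph.Walk.length_support, ← heq]
    rw [← heq] at hle
    omega
  · rw [internalVertices, ← heq]
    ext x
    simp only [mem_sdiff, mem_insert, mem_singleton]
    constructor
    · rintro ⟨rfl | rfl | h, h'⟩ <;> tauto
    · rintro h
      exact ⟨.inr (.inr h), by rintro (rfl | rfl) <;> contradiction⟩

/-- A path that repeats the pattern `w`, `r`, `u`, `s`. -/
theorem exists_path_of_interleaved {V : Type*} [DecidableEq V] (H : ℕ → SimpleGraph V) (L : ℕ)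
    (w r u s : ℕ → V) (hwr : ∀ j ≤ L, (H (4 * j)).Adj (w j) (r j))
    (hru : ∀ j ≤ L, (H (4 * j + 1)).Adj (r j) (u j))
    (hus : ∀ j < L, (H (4 * j + 2)).Adj (u j) (s j))
    (hsw : ∀ j < L, (H (4 * j + 3)).Adj (s j) (w (j + 1)))
    {B : Finset V} (hne : w 0 ≠ u L) (h0 : w 0 ∉ B) (hL : u L ∉ B) (hB : #B = 4 * L + 1)
    (hcov : ∀ v ∈ B, (∃ j ≤ L, r j = v) ∨ ∃ j < L, u j = v ∨ s j = v ∨ w (j + 1) = v) :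
    ∃ P : (⊤ : SimpleGraph V).Walk (w 0) (u L), P.IsPath ∧ P.length = 4 * L + 2 ∧
      (∀ k < 4 * L + 2, (H k).Adj (P.getVert k) (P.getVert (k + 1))) ∧
      internalVertices P = B := by
  obtain ⟨p, hp⟩ : ∃ p : ℕ → V, ∀ j, p (4 * j) = w j ∧ p (4 * j + 1) = r j ∧
      p (4 * j + 2) = u j ∧ p (4 * j + 3) = s j := by
    refine ⟨fun k ↦ if k % 4 = 0 then w (k / 4) else if k % 4 = 1 then r (k / 4) else
      if k % 4 = 2 then u (k / 4) else s (k / 4), fun j ↦ ?_⟩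
    simp only [Nat.mul_add_mod, Nat.mul_mod_right, Nat.mul_add_div (show 4 > 0 by omega),
      Nat.mul_div_cancel_left j (show 0 < 4 by omega)]
    norm_num
  have hadj : ∀ k < 4 * L + 2, (H k).Adj (p k) (p (k + 1)) := by
    intro k hk
    obtain ⟨j, hj⟩ : ∃ j, k = 4 * j ∨ k = 4 * j + 1 ∨ k = 4 * j + 2 ∨ k = 4 * j + 3 :=
      ⟨k / 4, by omega⟩
    obtain ⟨pw, pr, pu, ps⟩ := hp j
    rcases hj with rfl | rfl | rfl | rfl
    · rw [pw, pr]; exact hwr j (by omega)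
    · rw [pr, pu]; exact hru j (by omega)
    · rw [pu, ps]; exact hus j (by omega)
    · rw [ps, show 4 * j + 3 + 1 = 4 * (j + 1) by ring, (hp (j + 1)).1]
      exact hsw j (by omega)
  obtain ⟨P, hPl, hPv⟩ := exists_walk_of_adj (H := ⊤) (4 * L + 2) p
    fun i hi ↦ (SimpleGraph.top_adj _ _).2 (hadj i hi).ne
  have hend : p (4 * L + 2) = u L := (hp L).2.2.1
  have hstart : p 0 = w 0 := (hp 0).1
  rw [← hstart, ← hend] at hne ⊢
  rw [← hstart] at h0
  rw [← hend] at hL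
  have hmem : ∀ k ≤ 4 * L + 2, p k ∈ P.support.toFinset := fun k hk ↦ by
    rw [List.mem_toFinset, ← hPv k hk]
    exact P.getVert_mem_support k
  obtain ⟨h1, h2⟩ := P.isPath_and_internalVertices_eq hne h0 hL (by omega) <| by
    intro v hv
    rcases hcov v hv with ⟨j, hj, rfl⟩ | ⟨j, hj, rfl | rfl | rfl⟩
    · rw [← (hp j).2.1]; exact hmem _ (by omega)
    · rw [← (hp j).2.2.1]; exact hmem _ (by omega)
    · rw [← (hp j).2.2.2]; exact hmem _ (by omega)
    · rw [← (hp (j + 1)).1]; exact hmem _ (by omega)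
  refine ⟨P, h1, hPl, fun k hk ↦ ?_, h2⟩
  rw [hPv k (by omega), hPv (k + 1) (by omega)]
  exact hadj k hk

/-! ### The absorber -/

/-- If any two vertices have many common neighbours, for any two graphs of the collection, then
every bipartite graph `E` on `X` and `Y ⊕ W` gives an absorbing set for the vertices `ζ w`. -/
theorem exists_absorber {V X Y W : Type*} [Fintype V] [DecidableEq V] [Fintype X] [DecidableEq X]
    [Fintype Y] [DecidableEq Y] [DecidableEq W] (H : ℕ → SimpleGraph V)
    [∀ k, DecidableRel (H k).Adj] (E : Finset (X × (Y ⊕ W))) (D : ℕ)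
    (hD : ∀ k l x y, D ≤ #{v | (H k).Adj x v ∧ (H l).Adj v y})
    {z₁ z₂ : V} (hz : z₁ ≠ z₂) (Z₀ : Finset V) (h₁ : z₁ ∉ Z₀) (h₂ : z₂ ∉ Z₀) (ζ : W → V)
    (hζ : Function.Injective ζ) (hζZ : ∀ i, ζ i ∈ Z₀) (L a : ℕ) (hL : L = #E + Fintype.card X)
    (ha : a = Fintype.card Y + #E + 3 * L + 1) (hsize : #Z₀ + 2 + a ≤ D) :
    ∃ A : Finset V, #A = a ∧ Disjoint A (insert z₁ (insert z₂ Z₀)) ∧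
      ∀ (W' : Finset W) (m : X → Y ⊕ W), Fintype.card Y + #W' = Fintype.card X →
        (∀ x, (x, m x) ∈ E) → univ.image m = (univ : Finset Y).disjSum W' →
        ∃ P : (⊤ : SimpleGraph V).Walk z₁ z₂, P.IsPath ∧ P.length = 4 * L + 2 ∧
          (∀ k < 4 * L + 2, (H k).Adj (P.getVert k) (P.getVert (k + 1))) ∧
          internalVertices P = A ∪ W'.image ζ := by
  have hJ : Fintype.card (E ⊕ X) = L := by rw [Fintype.card_sum, Fintype.card_coe, hL]
  let σ : E ⊕ X ≃ Fin L := Fintype.equivFinOfCardEq hJ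
  set Z : Finset V := insert z₁ (insert z₂ Z₀) with hZ
  have hZc : #Z = #Z₀ + 2 := by
    rw [hZ, card_insert_of_notMem (by simp [hz, h₁]), card_insert_of_notMem h₂]
  have hDV : D ≤ #(univ : Finset V) := (hD 0 0 z₁ z₁).trans (card_le_card (subset_univ _))
  -- `g` provides the vertices for Y and the two ends of each slot of X.
  obtain ⟨g, -, hgc, -, -⟩ := exists_injective_mem_notMem
    (fun _ : Y ⊕ X ⊕ X ↦ (univ : Finset V)) Z (fun _ ↦ by
      simp only [Fintype.card_sum]; omega)
  set F₂ := Z ∪ univ.image g with hF₂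
  have hcE : Fintype.card E = #E := Fintype.card_coe E
  simp only [Fintype.card_sum] at hgc
  obtain ⟨y, hyN, hyc, -, -⟩ := exists_injective_mem_notMem
    (fun e : E ↦ ({v | (H (4 * (σ (.inr e.1.1)) + 2)).Adj (g (.inr (.inl e.1.1))) v ∧
      (H (4 * (σ (.inr e.1.1)) + 3)).Adj v (g (.inr (.inr e.1.1)))} : Finset V)) F₂
    (fun _ ↦ le_trans (by omega) (hD _ _ _ _))
  set F₃ := F₂ ∪ univ.image y with hF₃
  let emb : Y ⊕ W → V := Sum.elim (fun i ↦ g (.inl i)) ζ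
  -- The two ends of the slot of e: each sees both `emb e.1.2` and `y e` in the same graph, so these
  -- two are interchangeable as middle.
  obtain ⟨q, hqN, hqc, -, -⟩ := exists_injective_mem_notMem
    (Sum.elim (fun e : E ↦ ({v | (H (4 * (σ (.inl e)) + 2)).Adj (emb e.1.2) v ∧
        (H (4 * (σ (.inl e)) + 2)).Adj v (y e)} : Finset V))
      (fun e : E ↦ ({v | (H (4 * (σ (.inl e)) + 3)).Adj (emb e.1.2) v ∧
        (H (4 * (σ (.inl e)) + 3)).Adj v (y e)} : Finset V))) F₃
    (by
      rintro (e | e)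
      all_goals
        refine le_trans ?_ (hD _ _ _ _)
        rw [Fintype.card_sum]
        omega)
  set F₄ := F₃ ∪ univ.image q with hF₄
  simp only [Fintype.card_sum] at hqc
  let u : E ⊕ X → V := Sum.elim (fun e ↦ q (.inl e)) (fun x ↦ g (.inr (.inl x)))
  let w : E ⊕ X → V := Sum.elim (fun e ↦ q (.inr e)) (fun x ↦ g (.inr (.inr x)))
  -- Slot j runs from `u' j` to `w' (j + 1)`. With this shift the defaults give `w' 0 = z₁` and `u'
  -- L = z₂`, so the connector `r j` joins `w' j` to `u' j` at the ends of the path too.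
  let u' : ℕ → V := fun j ↦ if h : j < L then u (σ.symm ⟨j, h⟩) else z₂
  let w' : ℕ → V := fun j ↦ if h : j - 1 < L ∧ 0 < j then w (σ.symm ⟨j - 1, h.1⟩) else z₁
  have hu' : ∀ j, u' (σ j) = u j := fun j ↦ by simp [u']
  have hw' : ∀ j, w' (σ j + 1) = w j := fun j ↦ by simp [w']
  obtain ⟨r, hrN, hrc, -, -⟩ := exists_injective_mem_notMem
    (fun j : Fin (L + 1) ↦ ({v | (H (4 * j)).Adj (w' j) v ∧
      (H (4 * j + 1)).Adj v (u' j)} : Finset V)) F₄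
    (fun _ ↦ le_trans (by rw [Fintype.card_fin]; omega) (hD _ _ _ _))
  rw [Fintype.card_fin] at hrc
  set F₅ := F₄ ∪ univ.image r with hF₅
  have hZF : Z ⊆ F₅ := by
    rw [hF₅, hF₄, hF₃, hF₂]
    intro v hv
    simp only [mem_union]
    tauto
  refine ⟨F₅ \ Z, by rw [card_sdiff_of_subset hZF]; omega, disjoint_sdiff_self_left,
    fun W' m hcard hmE hm ↦ ?_⟩
  let s : E ⊕ X → V := Sum.elim (fun e ↦ if m e.1.1 = e.1.2 then emb e.1.2 else y e)
    (fun x ↦ y ⟨(x, m x), hmE x⟩)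
  let s' : ℕ → V := fun j ↦ if h : j < L then s (σ.symm ⟨j, h⟩) else z₁
  let r' : ℕ → V := fun j ↦ if h : j < L + 1 then r ⟨j, h⟩ else z₁
  have hs' : ∀ j, s' (σ j) = s j := fun j ↦ by simp [s']
  have hr' : ∀ j : Fin (L + 1), r' j = r j := fun j ↦ dif_pos j.2
  have hus : ∀ j, (H (4 * (σ j) + 2)).Adj (u j) (s j) := by
    rintro (e | x)
    · have := hqN (.inl e)
      simp only [Sum.elim_inl, mem_filter, mem_univ, true_and] at this
      simp only [u, s, Sum.elim_inl]
      split_ifs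
      exacts [this.1.symm, this.2]
    · have := hyN ⟨(x, m x), hmE x⟩
      simp only [mem_filter, mem_univ, true_and] at this
      exact this.1
  have hsw : ∀ j, (H (4 * (σ j) + 3)).Adj (s j) (w j) := by
    rintro (e | x)
    · have := hqN (.inr e)
      simp only [Sum.elim_inr, mem_filter, mem_univ, true_and] at this
      simp only [w, s, Sum.elim_inl]
      split_ifs
      exacts [this.1, this.2.symm]
    · have := hyN ⟨(x, m x), hmE x⟩
      simp only [mem_filter, mem_univ, true_and] at this
      exact this.2
  have hsurj : ∀ j < L, ∃ i, j = σ i := fun j hj ↦ ⟨σ.symm ⟨j, hj⟩, by simp⟩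
  have hr : ∀ j ≤ L, (H (4 * j)).Adj (w' j) (r' j) ∧ (H (4 * j + 1)).Adj (r' j) (u' j) := by
    intro j hj
    have := hrN ⟨j, by omega⟩
    simp only [mem_filter, mem_univ, true_and, ← hr'] at this
    exact this
  have hmatch : ∀ v : Y ⊕ W, v ∈ (univ : Finset Y).disjSum W' → ∃ j, s j = emb v := by
    intro v hv
    rw [← hm] at hv
    obtain ⟨x, -, rfl⟩ := mem_image.1 hv
    exact ⟨.inl ⟨(x, m x), hmE x⟩, by simp [s]⟩
  have hw0 : w' 0 = z₁ := by simp [w']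
  have huL : u' L = z₂ := by simp [u']
  have hWZ : W'.image ζ ⊆ Z₀ := image_subset_iff.2 fun i _ ↦ hζZ i
  have hAZ : Disjoint (F₅ \ Z) (W'.image ζ) :=
    disjoint_sdiff_self_left.mono_right (hWZ.trans fun v hv ↦ by simp [hZ, hv])
  have key := exists_path_of_interleaved H L w' r' u' s' (fun j hj ↦ (hr j hj).1)
    (fun j hj ↦ (hr j hj).2)
    (fun j hj ↦ by obtain ⟨i, rfl⟩ := hsurj j hj; rw [hu', hs']; exact hus i)
    (fun j hj ↦ by obtain ⟨i, rfl⟩ := hsurj j hj; rw [hw', hs']; exact hsw i)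
    (B := F₅ \ Z ∪ W'.image ζ)
  rw [hw0, huL] at key
  refine key hz ?_ ?_ ?_ ?_
  · rw [mem_union, not_or]
    exact ⟨fun h ↦ (mem_sdiff.1 h).2 (by simp [hZ]), fun h ↦ h₁ (hWZ h)⟩
  · rw [mem_union, not_or]
    exact ⟨fun h ↦ (mem_sdiff.1 h).2 (by simp [hZ]), fun h ↦ h₂ (hWZ h)⟩
  · rw [card_union_of_disjoint hAZ, card_sdiff_of_subset hZF, card_image_of_injective _ hζ]
    omega
  · intro v hv
    have hslot : (∃ j, u j = v ∨ s j = v ∨ w j = v) →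
        ∃ j < L, u' j = v ∨ s' j = v ∨ w' (j + 1) = v := by
      rintro ⟨j, hj⟩
      refine ⟨σ j, (σ j).2, ?_⟩
      rwa [hu', hs', hw']
    rcases mem_union.1 hv with hv | hv
    · obtain ⟨hv, hvZ⟩ := mem_sdiff.1 hv
      simp only [hF₅, hF₄, hF₃, hF₂, mem_union, hvZ, false_or, mem_image, mem_univ,
        true_and] at hv
      rcases hv with ((⟨(i | x | x), rfl⟩ | ⟨e, rfl⟩) | ⟨(e | e), rfl⟩) | ⟨j, rfl⟩
      · obtain ⟨j, hj⟩ := hmatch (.inl i) (inl_mem_disjSum.2 (mem_univ _))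
        exact .inr (hslot ⟨j, .inr (.inl hj)⟩)
      · exact .inr (hslot ⟨.inr x, .inl rfl⟩)
      · exact .inr (hslot ⟨.inr x, .inr (.inr rfl)⟩)
      · by_cases he : m e.1.1 = e.1.2
        · refine .inr (hslot ⟨.inr e.1.1, .inr (.inl ?_)⟩)
          simp only [s, Sum.elim_inr]
          congr 1
          exact Subtype.ext (Prod.ext rfl he)
        · exact .inr (hslot ⟨.inl e, .inr (.inl (by simp [s, he]))⟩)
      · exact .inr (hslot ⟨.inl e, .inl rfl⟩)
      · exact .inr (hslot ⟨.inl e, .inr (.inr rfl)⟩)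
      · exact .inl ⟨j, by omega, hr' j⟩
    · obtain ⟨i, hi, rfl⟩ := mem_image.1 hv
      obtain ⟨j, hj⟩ := hmatch (.inr i) (inr_mem_disjSum.2 hi)
      exact .inr (hslot ⟨j, .inr (.inl hj)⟩)

/-! ### Minimum degree and constants -/

theorem SimpleGraph.le_card_common_neighbors {V : Type*} [Fintype V] [DecidableEq V]
    (G H : SimpleGraph V) [DecidableRel G.Adj] [DecidableRel H.Adj] (x y : V) :
    G.minDegree + H.minDegree ≤ #{v | G.Adj x v ∧ H.Adj v y} + Fintype.card V := by
  have h1 := G.minDegree_le_degree x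
  have h2 := H.minDegree_le_degree y
  have h3 := card_union_add_card_inter (G.neighborFinset x) (H.neighborFinset y)
  have h4 := card_le_univ (G.neighborFinset x ∪ H.neighborFinset y)
  have h5 : G.neighborFinset x ∩ H.neighborFinset y =
      ({v | G.Adj x v ∧ H.Adj v y} : Finset V) := by
    ext v
    simp [H.adj_comm]
  rw [G.card_neighborFinset_eq_degree, H.card_neighborFinset_eq_degree, h5] at h3
  omega

theorem lemma3p1 :
    ∃ f : ℝ → ℝ, Monotone f ∧ (∀ x : ℝ, 0 < x → 0 < f x) ∧
      ∀ (α β γ : ℝ) (n : ℕ),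
        0 < α → α ≤ 1 →
        0 < β → β ≤ f α →
        0 < γ → γ ≤ f β →
        0 < n → 1 / (n : ℝ) ≤ f γ →
        ∀ b c : ℕ, |(b : ℝ) - β * n| < 1 → |(c : ℝ) - γ * n| < 1 →
          ∃ a : ℕ, (a : ℝ) ≤ 500 * β * n ∧
            ∀ (G : Fin (a + b + 1) → SimpleGraph (Fin n)) [∀ i, DecidableRel (G i).Adj],
              (∀ i, (1 / 2 + α) * (n : ℝ) ≤ ((G i).minDegree : ℝ)) →
              ∀ (Z : Finset (Fin n)), Z.card = b + c + 2 →
                ∀ z₁ ∈ Z, ∀ z₂ ∈ Z, z₁ ≠ z₂ →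
                  ∃ A : Finset (Fin n), Disjoint A Z ∧ A.card = a ∧
                    ∀ Z' ⊆ Z \ {z₁, z₂}, Z'.card = b →
                      ∃ P : (⊤ : SimpleGraph (Fin n)).Walk z₁ z₂,
                        P.IsPath ∧ FollowsCollection G P ∧
                          internalVertices P = A ∪ Z' := by
  -- A linear `f` suffices: γn ≥ 1000, and βn and αn each gain a further factor 1000, which absorbs
  -- the rounding errors.
  refine ⟨fun x ↦ x / 1000, fun x y h ↦ by dsimp only; linarith, fun x hx ↦ by positivity, ?_⟩
  intro α β γ n _ _ _ hβα _ hγβ hn hnγ b c hb hc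
  have hn' : (0 : ℝ) < n := by exact_mod_cast hn
  have hγn : 1000 ≤ γ * n := by
    rw [div_le_iff₀ hn'] at hnγ
    linarith
  have hβn : 1000 * (γ * n) ≤ β * n := by nlinarith
  have hαn : 1000 * (β * n) ≤ α * n := by nlinarith
  rw [abs_lt] at hb hc
  have hcb : 2 * c ≤ b := by
    have : (2 * c : ℝ) ≤ b := by linarith
    exact_mod_cast this
  obtain ⟨E, hE, hmatch⟩ := exists_robustly_matchable b c (by omega)
  obtain ⟨L, hL⟩ : ∃ L, L = #E + 3 * b := ⟨_, rfl⟩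
  -- `a` depends only on `E`, which is fixed before G. As 2c ≤ b, #E ≤ 78b and L ≤ 81b, whence the
  -- 323.
  obtain ⟨a, ha⟩ : ∃ a, a = 2 * b + #E + 3 * L + 1 := ⟨_, rfl⟩
  have hab : a ≤ 323 * b + 1 := by omega
  have hab' : (a : ℝ) ≤ 323 * b + 1 := by exact_mod_cast hab
  refine ⟨a, by linarith, fun G _ hG Z hZ z₁ hz₁ z₂ hz₂ hz ↦ ?_⟩
  have ht : 0 < a + b + 1 := by omega
  -- Periodic extension keeps the degree condition at every index.
  let H : ℕ → SimpleGraph (Fin n) := fun k ↦ G ⟨k % (a + b + 1), Nat.mod_lt _ ht⟩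
  let : ∀ k, DecidableRel (H k).Adj := fun k ↦
    inferInstanceAs (DecidableRel (G ⟨k % (a + b + 1), Nat.mod_lt _ ht⟩).Adj)
  have hH : ∀ k, (1 / 2 + α) * (n : ℝ) ≤ ((H k).minDegree : ℝ) := fun k ↦ hG _
  have hD : ∀ k l x y, b + c + 2 + a ≤ #{v | (H k).Adj x v ∧ (H l).Adj v y} := by
    intro k l x y
    have h1 : (((H k).minDegree + (H l).minDegree : ℕ) : ℝ) ≤
        ((#{v | (H k).Adj x v ∧ (H l).Adj v y} + Fintype.card (Fin n) : ℕ) : ℝ) :=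
      Nat.cast_le.2 ((H k).le_card_common_neighbors (H l) x y)
    rw [Fintype.card_fin] at h1
    push_cast at h1
    have h2 := hH k
    have h3 := hH l
    have h4 : (2 * c : ℝ) ≤ b := by exact_mod_cast hcb
    have : ((b + c + 2 + a : ℕ) : ℝ) ≤ (#{v | (H k).Adj x v ∧ (H l).Adj v y} : ℝ) := by
      push_cast
      linarith
    exact_mod_cast this
  set Z₀ := Z \ {z₁, z₂} with hZ₀
  have hZ₀c : #Z₀ = b + c := by
    rw [hZ₀, card_sdiff_of_subset (by simp [insert_subset_iff, hz₁, hz₂]), card_pair hz]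
    omega
  have hZ₀Z : insert z₁ (insert z₂ Z₀) = Z := by
    ext v
    simp only [hZ₀, mem_insert, mem_sdiff, mem_singleton]
    constructor
    · rintro (rfl | rfl | h) <;> tauto
    · tauto
  let ζ : Fin (b + c) ≃ Z₀ := (Z₀.equivFinOfCardEq hZ₀c).symm
  obtain ⟨A, hA, hAZ, habs⟩ := exists_absorber H E (b + c + 2 + a) hD hz Z₀ (by simp [hZ₀])
    (by simp [hZ₀]) (fun i ↦ (ζ i : Fin n)) (Subtype.val_injective.comp ζ.injective)
    (fun i ↦ (ζ i).2) L a (by rw [Fintype.card_fin, hL]) (by rw [Fintype.card_fin, ha])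
    (by omega)
  rw [hZ₀Z] at hAZ
  refine ⟨A, hAZ, hA, fun Z' hZ' hZ'b ↦ ?_⟩
  have himage : image (fun i ↦ (ζ i : Fin n)) {i | (ζ i : Fin n) ∈ Z'} = Z' := by
    ext v
    simp only [mem_image, mem_filter, mem_univ, true_and]
    constructor
    · rintro ⟨i, hi, rfl⟩
      exact hi
    · intro hv
      exact ⟨ζ.symm ⟨v, hZ' hv⟩, by simpa using hv, by simp⟩
  have hcard : #{i | (ζ i : Fin n) ∈ Z'} = b := by
    rw [← card_image_of_injective _ (Subtype.val_injective.comp ζ.injective)]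
    exact (congrArg Finset.card himage).trans hZ'b
  obtain ⟨m, hmE, hm⟩ := hmatch _ hcard
  obtain ⟨P, hP, hPl, hPH, hPi⟩ := habs _ m (by simp only [Fintype.card_fin, hcard]; omega) hmE hm
  -- The lengths agree: a + b + 1 = 3b + #E + 3L + 2 = 4L + 2.
  refine ⟨P, hP, ⟨by omega, fun i ↦ ?_⟩, by rw [hPi, himage]⟩
  have h := hPH i (by omega)
  have hi : (⟨i % (a + b + 1), Nat.mod_lt _ ht⟩ : Fin (a + b + 1)) = i :=
    Fin.ext (Nat.mod_eq_of_lt i.2)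
  simp only [H, hi] at h
  exact h
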